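/- All graphs are finite and simple. A graph is disconnected if it has two vertices that are not joined by a path, and $G^c$ denotes the complement of $G$ on the same vertex set. For a field $k$ and a graph $G$ with vertices $x_1,\dots,x_n$, let $R=k[x_1,\dots,x_n]$, let $I(G)\subseteq R$ be the ideal generated by the monomials $x_ix_j$ for all edges $\{x_i,x_j\}$ of $G$, and let $\operatorname{pd}^k(G)$ be the projective dimension of the $R$-module $R/I(G)$. **Theorem.** Let $k$ be any field and $G$ a graph. 1. If $H$ is an induced subgraph of $G$ such that $H^c$ is disconnected, then $\operatorname{pd}^k(G)\ge |V(H)|-1$. 2. If $G^c$ is disconnected, then $\operatorname{pd}^k(G)=|V(G)|-1$. 3. If the complete graph $K_n$ ($n\ge 2$) is isomorphic to an induced subgraph of $G$, then $\operatorname{pd}^k(G)\ge n-1$; if the complete bipartite graph $K_{n,m}$ ($n,m\ge 1$) is isomorphic to an induced subgraph of $G$, then $\operatorname{pd}^k(G)\ge n+m-1$. 4. $\operatorname{pd}^k(K_n)=n-1$ for $n\ge 2$, and $\operatorname{pd}^k(K_{n,m})=n+m-1$ for $n,m\ge 1$. -/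

import Mathlib

/-- The graph ideal `I(G)` of the polynomial ring over `k` with one variable per vertex,
generated by the monomials `x_i x_j` for the edges `{x_i, x_j}` of `G`. -/
noncomputable def graphIdeal (k : Type*) [Field k] {V : Type*} (G : SimpleGraph V) :
    Ideal (MvPolynomial V k) :=
  Ideal.span {f | ∃ i j : V, G.Adj i j ∧ f = MvPolynomial.X i * MvPolynomial.X j}

/-- The projective dimension of a graph over `k`: the projective dimension of the quotient of the
polynomial ring by the graph ideal, as a module over the polynomial ring. -/
noncomputable def graphPd (k : Type*) [Field k] {V : Type*} (G : SimpleGraph V) : WithBot ℕ∞ :=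
  CategoryTheory.projectiveDimension
    (ModuleCat.of (MvPolynomial V k) (MvPolynomial V k ⧸ graphIdeal k G))

open CategoryTheory Abelian RingTheory.Sequence

section Homological

universe u

variable {R : Type u} [CommRing R]

/-- Multiplication by `x` and the projection form a short exact sequence
`0 → R ⧸ (J : x) → R ⧸ J → R ⧸ (J + (x)) → 0`. -/
theorem exists_shortExact_colon (J K : Ideal R) (x : R) (hK : ∀ f, f ∈ K ↔ x * f ∈ J) :
    ∃ (f : ModuleCat.of R (R ⧸ K) ⟶ ModuleCat.of R (R ⧸ J))
      (g : ModuleCat.of R (R ⧸ J) ⟶ ModuleCat.of R (R ⧸ (J ⊔ Ideal.span {x}))) (w : f ≫ g = 0),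
      (ShortComplex.mk f g w).ShortExact := by
  let f : (R ⧸ K) →ₗ[R] (R ⧸ J) :=
    Submodule.mapQ K J (LinearMap.lsmul R R x) fun a ha => (hK a).1 ha
  let g : (R ⧸ J) →ₗ[R] (R ⧸ (J ⊔ Ideal.span {x})) := Submodule.factor le_sup_left
  have hfg : Function.Exact f g := by
    intro y
    obtain ⟨y, rfl⟩ := Submodule.mkQ_surjective _ y
    constructor
    · intro hy
      have hyJ : y ∈ J ⊔ Ideal.span {x} := (Submodule.Quotient.mk_eq_zero _).1 hy
      obtain ⟨a, ha, b, hb, rfl⟩ := Submodule.mem_sup.1 hyJ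
      obtain ⟨c, rfl⟩ := Ideal.mem_span_singleton'.1 hb
      refine ⟨Submodule.Quotient.mk c, ?_⟩
      refine (Submodule.Quotient.eq J).2 ?_
      have : x * c - (a + c * x) = -a := by ring
      simpa [this] using ha
    · rintro ⟨c, hc⟩
      obtain ⟨c, rfl⟩ := Submodule.mkQ_surjective _ c
      rw [← hc]
      refine (Submodule.Quotient.mk_eq_zero _).2 ?_
      exact Submodule.mem_sup_right (Ideal.mul_mem_right _ _ (Ideal.mem_span_singleton_self x))
  refine ⟨ModuleCat.ofHom f, ModuleCat.ofHom g, ?_, ?_⟩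
  · exact ModuleCat.hom_ext hfg.linearMap_comp_eq_zero
  · refine ModuleCat.shortComplex_shortExact _ hfg ?_ ?_
    · refine (injective_iff_map_eq_zero f).2 fun a ha => ?_
      obtain ⟨a, rfl⟩ := Submodule.mkQ_surjective _ a
      exact (Submodule.Quotient.mk_eq_zero K).2 ((hK a).2 ((Submodule.Quotient.mk_eq_zero J).1 ha))
    · exact Submodule.factor_surjective le_sup_left

theorem hasProjectiveDimensionLT_quotient_of_colon {J K : Ideal R} {x : R}
    (hK : ∀ f, f ∈ K ↔ x * f ∈ J) {n : ℕ}
    (h₁ : HasProjectiveDimensionLT (ModuleCat.of R (R ⧸ K)) n)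
    (h₂ : HasProjectiveDimensionLT (ModuleCat.of R (R ⧸ (J ⊔ Ideal.span {x}))) n) :
    HasProjectiveDimensionLT (ModuleCat.of R (R ⧸ J)) n := by
  obtain ⟨f, g, w, h⟩ := exists_shortExact_colon J K x hK
  exact h.hasProjectiveDimensionLT_X₂ n h₁ h₂

theorem hasProjectiveDimensionLT_quotient_sup_span {J : Ideal R} {x : R}
    (hJ : ∀ f, f ∈ J ↔ x * f ∈ J) {n : ℕ}
    (h : HasProjectiveDimensionLT (ModuleCat.of R (R ⧸ J)) n) :
    HasProjectiveDimensionLT (ModuleCat.of R (R ⧸ (J ⊔ Ideal.span {x}))) (n + 1) := by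
  obtain ⟨f, g, w, hS⟩ := exists_shortExact_colon J J x hJ
  exact hS.hasProjectiveDimensionLT_X₃ n h (hasProjectiveDimensionLT_of_ge _ n _ n.le_succ)

/-- `Ext Q M i` vanishes below the length of an `M`-regular sequence that annihilates `Q`. -/
theorem ext_eq_zero_of_isWeaklyRegular (Q : ModuleCat.{u} R) (rs : List R)
    (hQ : ∀ r ∈ rs, r ∈ Module.annihilator R Q) (M : ModuleCat.{u} R)
    (reg : IsWeaklyRegular M rs) {i : ℕ} (hi : i < rs.length) (e : Ext Q M i) : e = 0 := by
  induction rs generalizing M i with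
  | nil => simp at hi
  | cons r rs ih =>
    obtain ⟨hr, hrs⟩ := (isWeaklyRegular_cons_iff M r rs).1 reg
    have hrQ := hQ r (by simp)
    cases i with
    | zero =>
      obtain ⟨f, rfl⟩ := (Ext.mk₀_bijective Q M).2 e
      have := IsSMulRegular.linearMap_subsingleton_of_mem_annihilator hr hrQ
      have hf : f = 0 := ModuleCat.hom_ext (Subsingleton.elim _ _)
      simp [hf]
    | succ j =>
      have hS := hr.smulShortComplex_shortExact
      have hzero : r • 𝟙 Q = 0 := by
        ext x
        exact Module.mem_annihilator.1 hrQ x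
      have he : e.comp (Ext.mk₀ (M.smulShortComplex r).f) (add_zero (j + 1)) = 0 := by
        have h1 : r • e = 0 := by
          have : r • e = (Ext.mk₀ (r • 𝟙 Q)).comp e (zero_add _) := by simp [Ext.mk₀_smul]
          rw [this, hzero]
          simp
        have h2 : e.comp (Ext.mk₀ (r • 𝟙 M)) (add_zero (j + 1)) = r • e := by
          simp [Ext.mk₀_smul]
        exact h2.trans h1
      obtain ⟨y, hy⟩ := Ext.covariant_sequence_exact₁ Q hS e he rfl
      have hy0 : y = 0 := ih (fun s hs => hQ s (by simp [hs]))
        (ModuleCat.of R (QuotSMulTop r M)) hrs (by simpa using hi) y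
      subst hy0
      exact hy.symm.trans (Ext.zero_comp ..)

/-- A weakly regular sequence on the ring remains so on every flat module. -/
theorem isWeaklyRegular_of_flat (M : Type u) [AddCommGroup M] [Module R M] [Module.Flat R M]
    {rs : List R} (reg : IsWeaklyRegular R rs) : IsWeaklyRegular M rs :=
  ((TensorProduct.rid R M).isWeaklyRegular_congr rs).1 reg.isWeaklyRegular_lTensor

/-- If `M` has projective dimension at most `p` and `Q` is annihilated by a regular sequence of
length `n`, then `Ext Q M i` vanishes for `i + p < n`. -/
theorem ext_eq_zero_of_hasProjectiveDimensionLT (Q : ModuleCat.{u} R) (rs : List R)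
    (hQ : ∀ r ∈ rs, r ∈ Module.annihilator R Q) (reg : IsWeaklyRegular R rs) (p : ℕ)
    (M : ModuleCat.{u} R) [HasProjectiveDimensionLT M (p + 1)] {i : ℕ} (hi : i + p < rs.length)
    (e : Ext Q M i) : e = 0 := by
  induction p generalizing M i with
  | zero =>
    have : Projective M := projective_iff_hasProjectiveDimensionLT_one.2 ‹_›
    have : Module.Projective R M := (IsProjective.iff_projective M).2 this
    exact ext_eq_zero_of_isWeaklyRegular Q rs hQ M (isWeaklyRegular_of_flat M reg) hi e
  | succ p ih =>
    have hS := M.shortExact_projectiveShortComplex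
    have hX₂ : Projective M.projectiveShortComplex.X₂ := inferInstance
    have := (hS.hasProjectiveDimensionLT_X₃_iff p hX₂).1 ‹_›
    have : Module.Projective R M.projectiveShortComplex.X₂ := inferInstance
    obtain ⟨y, hy⟩ := Ext.covariant_sequence_exact₃ Q hS e rfl
      (ih M.projectiveShortComplex.X₁ (by lia) _)
    rw [← hy, ext_eq_zero_of_isWeaklyRegular Q rs hQ _
      (isWeaklyRegular_of_flat M.projectiveShortComplex.X₂ reg) (by lia) y]
    simp

/-- If `Ext (R ⧸ J) M 1` vanishes, every linear map `J → M` is multiplication with an element. -/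
theorem exists_smul_eq_of_ext_one_eq_zero (J : Ideal R) (M : Type u) [AddCommGroup M] [Module R M]
    (h : ∀ e : Ext (ModuleCat.of R (R ⧸ J)) (ModuleCat.of R M) 1, e = 0) (φ : J →ₗ[R] M) :
    ∃ m : M, ∀ x : J, φ x = (x : R) • m := by
  let S := ModuleCat.shortComplexOfCompEqZero (M := J) (N := R) (L := R ⧸ J) J.subtype
    (Submodule.mkQ J) (LinearMap.exact_subtype_mkQ J).linearMap_comp_eq_zero
  have hS : S.ShortExact := ModuleCat.shortComplex_shortExact _
    (LinearMap.exact_subtype_mkQ J) J.injective_subtype (Submodule.mkQ_surjective J)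
  obtain ⟨y, hy⟩ := Ext.contravariant_sequence_exact₁ hS (ModuleCat.of R M)
    (Ext.mk₀ (ModuleCat.ofHom φ)) (add_zero 1) (h _)
  obtain ⟨ψ, rfl⟩ := (Ext.mk₀_bijective _ _).2 y
  rw [Ext.mk₀_comp_mk₀] at hy
  have hφ := (Ext.mk₀_bijective _ _).1 hy
  refine ⟨ψ.hom (1 : R), fun x => ?_⟩
  have h1 : φ x = ψ.hom (x : R) := (congrArg (fun f => f.hom x) hφ).symm
  rw [h1, ← map_smul]
  congr 1
  exact (mul_one (x : R)).symm

/-- If `a ∩ b ⊆ I`, there is a linear map `a + b → R ⧸ I` that is the projection on `a` and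
vanishes on `b`. -/
theorem exists_linearMap_sup_of_inf_le {a b I : Ideal R} (h : a ⊓ b ≤ I) :
    ∃ φ : ↥(a ⊔ b) →ₗ[R] R ⧸ I,
      (∀ x (hx : x ∈ a), φ ⟨x, Submodule.mem_sup_left hx⟩ = Submodule.Quotient.mk x) ∧
      ∀ x (hx : x ∈ b), φ ⟨x, Submodule.mem_sup_right hx⟩ = 0 := by
  let π : a →ₗ[R] R ⧸ I := Submodule.mkQ I ∘ₗ a.subtype
  let α := Submodule.liftQ (Submodule.comap a.subtype a ⊓ Submodule.comap a.subtype b) π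
    fun x hx => (Submodule.Quotient.mk_eq_zero I).2 (h hx)
  refine ⟨α ∘ₗ (LinearMap.quotientInfEquivSupQuotient a b).symm.toLinearMap ∘ₗ Submodule.mkQ _,
    fun x hx => ?_, fun x hx => ?_⟩
  · have := LinearMap.quotientInfEquivSupQuotient_symm_apply_left a b
      ⟨x, Submodule.mem_sup_left hx⟩ hx
    exact congrArg α this
  · have : (Submodule.mkQ (Submodule.comap (a ⊔ b).subtype b)) ⟨x, Submodule.mem_sup_right hx⟩ = 0 :=
      (Submodule.Quotient.mk_eq_zero _).2 hx
    exact (congrArg (fun y => α ((LinearMap.quotientInfEquivSupQuotient a b).symm y)) this).trans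
      (by rw [map_zero, map_zero])

end Homological

section Graph

open MvPolynomial

variable (k : Type*) [Field k] {V : Type*} (G : SimpleGraph V)

/-- The ideal generated by the edges of `G` and the variables in `S`. -/
noncomputable def graphVertexIdeal (S : Set V) : Ideal (MvPolynomial V k) :=
  graphIdeal k G ⊔ Ideal.span (X '' S)

variable {k G}

theorem mem_graphVertexIdeal {S : Set V} {f : MvPolynomial V k} :
    f ∈ graphVertexIdeal k G S ↔ ∀ m ∈ f.support,
      (∃ i ∈ S, m i ≠ 0) ∨ ∃ i j, G.Adj i j ∧ m i ≠ 0 ∧ m j ≠ 0 := by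
  have hspan : graphVertexIdeal k G S = Ideal.span ((fun m => monomial m (1 : k)) ''
      ({m | ∃ i j, G.Adj i j ∧ m = Finsupp.single i 1 + Finsupp.single j 1} ∪
        (fun i => Finsupp.single i 1) '' S)) := by
    have hedges : {f : MvPolynomial V k | ∃ i j : V, G.Adj i j ∧ f = X i * X j} =
        (fun m => monomial m (1 : k)) ''
          {m | ∃ i j, G.Adj i j ∧ m = Finsupp.single i 1 + Finsupp.single j 1} := by
      ext f
      constructor
      · rintro ⟨i, j, h, rfl⟩
        exact ⟨_, ⟨i, j, h, rfl⟩, by simp [X, monomial_mul]⟩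
      · rintro ⟨_, ⟨i, j, h, rfl⟩, rfl⟩
        exact ⟨i, j, h, by simp [X, monomial_mul]⟩
    have hvars : (X '' S : Set (MvPolynomial V k)) =
        (fun m => monomial m (1 : k)) '' ((fun i => Finsupp.single i 1) '' S) := by
      rw [Set.image_image]
      rfl
    rw [Set.image_union, Ideal.span_union, ← hedges, ← hvars, graphVertexIdeal, graphIdeal]
  rw [hspan, mem_ideal_span_monomial_image]
  refine forall₂_congr fun m _ => ?_
  constructor
  · rintro ⟨_, ⟨i, j, h, rfl⟩ | ⟨i, hi, rfl⟩, hm⟩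
    · have hi := hm i
      have hj := hm j
      simp only [Finsupp.add_apply, Finsupp.single_eq_same] at hi hj
      exact Or.inr ⟨i, j, h, by lia, by lia⟩
    · have := hm i
      simp only [Finsupp.single_eq_same] at this
      exact Or.inl ⟨i, hi, by lia⟩
  · rintro (⟨i, hi, hm⟩ | ⟨i, j, h, hi, hj⟩)
    · exact ⟨_, Or.inr ⟨i, hi, rfl⟩, by simpa using Nat.one_le_iff_ne_zero.2 hm⟩
    · refine ⟨_, Or.inl ⟨i, j, h, rfl⟩, fun v => ?_⟩
      have hij := h.ne
      classical
      simp only [Finsupp.add_apply, Finsupp.single_apply]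
      split_ifs <;> simp_all <;> lia

theorem graphVertexIdeal_empty : graphVertexIdeal k G ∅ = graphIdeal k G := by
  simp [graphVertexIdeal]

theorem mem_graphIdeal {f : MvPolynomial V k} :
    f ∈ graphIdeal k G ↔ ∀ m ∈ f.support, ∃ i j, G.Adj i j ∧ m i ≠ 0 ∧ m j ≠ 0 := by
  rw [← graphVertexIdeal_empty, mem_graphVertexIdeal]
  simp

theorem graphVertexIdeal_insert (S : Set V) (v : V) :
    graphVertexIdeal k G (insert v S) = graphVertexIdeal k G S ⊔ Ideal.span {X v} := by
  rw [graphVertexIdeal, graphVertexIdeal, Set.image_insert_eq, Ideal.span_insert, sup_assoc,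
    sup_comm (Ideal.span {X v})]

theorem forall_mem_support_X_mul {p : (V →₀ ℕ) → Prop} {v : V} {f : MvPolynomial V k} :
    (∀ m ∈ (X v * f).support, p m) ↔ ∀ m ∈ f.support, p (Finsupp.single v 1 + m) := by
  simp [support_X_mul]

/-- Dividing by a variable `v ∉ S` adds the neighbours of `v` to `S`. -/
theorem X_mul_mem_graphVertexIdeal {S : Set V} {v : V} (hv : v ∉ S) {f : MvPolynomial V k} :
    X v * f ∈ graphVertexIdeal k G S ↔ f ∈ graphVertexIdeal k G (S ∪ G.neighborSet v) := by
  rw [mem_graphVertexIdeal, mem_graphVertexIdeal, forall_mem_support_X_mul]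
  refine forall₂_congr fun m _ => ?_
  have key (i : V) (hi : i ≠ v) : (Finsupp.single v 1 + m : V →₀ ℕ) i = m i := by
    simp [Finsupp.single_eq_of_ne hi]
  constructor
  · rintro (⟨i, hi, hm⟩ | ⟨i, j, h, hi, hj⟩)
    · rw [key i (ne_of_mem_of_not_mem hi hv)] at hm
      exact Or.inl ⟨i, Or.inl hi, hm⟩
    · by_cases hiv : i = v
      · subst hiv
        rw [key j h.ne'] at hj
        exact Or.inl ⟨j, Or.inr h, hj⟩
      by_cases hjv : j = v
      · subst hjv
        rw [key i h.ne] at hi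
        exact Or.inl ⟨i, Or.inr h.symm, hi⟩
      rw [key i hiv] at hi
      rw [key j hjv] at hj
      exact Or.inr ⟨i, j, h, hi, hj⟩
  · have mono (i : V) (hi : m i ≠ 0) : (Finsupp.single v 1 + m : V →₀ ℕ) i ≠ 0 := by
      simp [hi]
    rintro (⟨i, hi | hi, hm⟩ | ⟨i, j, h, hi, hj⟩)
    · exact Or.inl ⟨i, hi, mono i hm⟩
    · exact Or.inr ⟨v, i, hi, by simp, mono i hm⟩
    · exact Or.inr ⟨i, j, h, mono i hi, mono j hj⟩

theorem hasProjectiveDimensionLT_quotient_variables (S : Finset V) :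
    HasProjectiveDimensionLT (ModuleCat.of (MvPolynomial V k)
      (MvPolynomial V k ⧸ graphVertexIdeal k (⊥ : SimpleGraph V) S)) (S.card + 1) := by
  classical
  induction S using Finset.induction_on with
  | empty =>
    have hbot : graphVertexIdeal k (⊥ : SimpleGraph V) ((∅ : Finset V) : Set V) = ⊥ := by
      simp [graphVertexIdeal, graphIdeal]
    rw [hbot]
    have : Module.Projective (MvPolynomial V k)
        (MvPolynomial V k ⧸ (⊥ : Ideal (MvPolynomial V k))) :=
      Module.Projective.of_equiv (Submodule.quotEquivOfEqBot ⊥ rfl).symm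
    rw [Finset.card_empty, zero_add, ← projective_iff_hasProjectiveDimensionLT_one,
      ← IsProjective.iff_projective]
    exact this
  | insert v S hv ih =>
    rw [Finset.coe_insert, graphVertexIdeal_insert, Finset.card_insert_of_notMem hv]
    refine hasProjectiveDimensionLT_quotient_sup_span (fun f => ?_) ih
    rw [X_mul_mem_graphVertexIdeal (by simpa using hv)]
    simp [SimpleGraph.neighborSet]

/-- Unless all variables are added, the quotient has projective dimension less than the number of
variables. -/
theorem hasProjectiveDimensionLT_quotient_graphVertexIdeal [Fintype V] (S : Finset V)
    (hS : S ≠ Finset.univ) :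
    HasProjectiveDimensionLT (ModuleCat.of (MvPolynomial V k)
      (MvPolynomial V k ⧸ graphVertexIdeal k G S)) (Fintype.card V) := by
  classical
  induction hn : Fintype.card V - S.card using Nat.strong_induction_on generalizing S with
  | _ n ih =>
    subst hn
    have hlt : S.card < Fintype.card V :=
      lt_of_le_of_ne (Finset.card_le_univ S) (mt (Finset.card_eq_iff_eq_univ S).1 hS)
    have step (T : Finset V) (hT : T ≠ Finset.univ) (hST : S ⊂ T) :=
      ih (Fintype.card V - T.card)
        (by have := Finset.card_lt_card hST; have := Finset.card_le_univ T; lia) T hT rfl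
    by_cases h : ∃ x y, x ∉ S ∧ y ∉ S ∧ G.Adj x y
    · obtain ⟨x, y, hx, hy, hxy⟩ := h
      have hcolon := step (S ∪ G.neighborFinset x)
        (fun hu => by simpa [hx] using Finset.eq_univ_iff_forall.1 hu x)
        (Finset.ssubset_iff_of_subset Finset.subset_union_left |>.2 ⟨y, by simpa using Or.inr hxy, hy⟩)
      have hinsert := step (insert x S)
        (fun hu => by simpa [hy, hxy.ne'] using Finset.eq_univ_iff_forall.1 hu y)
        (Finset.ssubset_insert hx)
      rw [Finset.coe_union, SimpleGraph.coe_neighborFinset] at hcolon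
      rw [Finset.coe_insert, graphVertexIdeal_insert] at hinsert
      exact hasProjectiveDimensionLT_quotient_of_colon
        (fun f => (X_mul_mem_graphVertexIdeal (by simpa using hx)).symm) hcolon hinsert
    · push Not at h
      have heq : graphVertexIdeal k G S = graphVertexIdeal k (⊥ : SimpleGraph V) S := by
        ext f
        rw [mem_graphVertexIdeal, mem_graphVertexIdeal]
        refine forall₂_congr fun m _ => ?_
        simp only [SimpleGraph.bot_adj, false_and, exists_false, or_false, or_iff_left_iff_imp]
        rintro ⟨i, j, hij, hi, hj⟩
        by_cases his : i ∈ S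
        · exact ⟨i, his, hi⟩
        · exact ⟨j, by_contra fun hjs => h i j his hjs hij, hj⟩
      rw [heq]
      have := hasProjectiveDimensionLT_quotient_variables (k := k) S
      exact hasProjectiveDimensionLT_of_ge _ _ _ hlt

theorem graphPd_le [Fintype V] [Nonempty V] :
    graphPd k G ≤ ((Fintype.card V - 1 : ℕ) : WithBot ℕ∞) := by
  have h := hasProjectiveDimensionLT_quotient_graphVertexIdeal (k := k) (G := G) ∅
    Finset.univ_nonempty.ne_empty.symm
  rw [Finset.coe_empty, graphVertexIdeal_empty] at h
  rw [graphPd, projectiveDimension_le_iff, HasProjectiveDimensionLE,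
    Nat.sub_add_cancel Fintype.card_pos]
  exact h

theorem isWeaklyRegular_map_X {l : List V} (hl : l.Nodup) :
    IsWeaklyRegular (MvPolynomial V k) (l.map X : List (MvPolynomial V k)) := by
  rw [isWeaklyRegular_iff]
  intro i hi
  rw [List.length_map] at hi
  have hI : (Ideal.ofList ((l.map X : List (MvPolynomial V k)).take i) • ⊤ : Ideal (MvPolynomial V k)) =
      graphVertexIdeal k (⊥ : SimpleGraph V) {v | v ∈ l.take i} := by
    rw [smul_eq_mul, Ideal.mul_top, ← List.map_take, Ideal.ofList]
    have : graphIdeal k (⊥ : SimpleGraph V) = ⊥ := by simp [graphIdeal]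
    rw [graphVertexIdeal, this, bot_sup_eq]
    congr 1
    ext f
    exact List.mem_map
  rw [hI, List.getElem_map, isSMulRegular_quotient_iff_mem_of_smul_mem]
  intro f hf
  have hv : l[i] ∉ l.take i := fun h => by
    obtain ⟨j, hj, hij⟩ := List.mem_take_iff_getElem.1 h
    have := (hl.getElem_inj_iff).1 hij
    lia
  rw [smul_eq_mul, X_mul_mem_graphVertexIdeal (S := {v | v ∈ l.take i}) hv] at hf
  simpa [SimpleGraph.neighborSet] using hf

/-- Two disjoint nonempty vertex sets that are completely joined bound the projective dimension
from below. -/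
theorem le_graphPd_of_join {A B : Finset V} (hA : A.Nonempty) (hB : B.Nonempty)
    (hAB : ∀ a ∈ A, ∀ b ∈ B, G.Adj a b) :
    ((A.card + B.card - 1 : ℕ) : WithBot ℕ∞) ≤ graphPd k G := by
  classical
  have hdisj : Disjoint A B :=
    Finset.disjoint_left.2 fun v ha hb => (hAB v ha v hb).ne rfl
  obtain ⟨a, ha⟩ := hA
  obtain ⟨b, hb⟩ := hB
  have hcA : 0 < A.card := Finset.card_pos.2 ⟨a, ha⟩
  have hcB : 0 < B.card := Finset.card_pos.2 ⟨b, hb⟩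
  rw [graphPd, projectiveDimension_ge_iff]
  intro hpd
  let IA : Ideal (MvPolynomial V k) := Ideal.span (X '' A)
  let IB : Ideal (MvPolynomial V k) := Ideal.span (X '' B)
  have hinf : IA ⊓ IB ≤ graphIdeal k G := by
    rintro f ⟨hfA, hfB⟩
    refine mem_graphIdeal.2 fun m hm => ?_
    obtain ⟨i, hi, him⟩ := mem_ideal_span_X_image.1 hfA m hm
    obtain ⟨j, hj, hjm⟩ := mem_ideal_span_X_image.1 hfB m hm
    exact ⟨i, j, hAB i hi j hj, him, hjm⟩
  obtain ⟨φ, hφA, hφB⟩ := exists_linearMap_sup_of_inf_le hinf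
  have hext : ∀ e : Ext (ModuleCat.of (MvPolynomial V k) (MvPolynomial V k ⧸ (IA ⊔ IB)))
      (ModuleCat.of (MvPolynomial V k) (MvPolynomial V k ⧸ graphIdeal k G)) 1, e = 0 := by
    intro e
    have hp : A.card + B.card - 1 = (A.card + B.card - 2) + 1 := by lia
    rw [hp] at hpd
    refine ext_eq_zero_of_hasProjectiveDimensionLT _ ((A ∪ B).toList.map X) ?_
      (isWeaklyRegular_map_X (Finset.nodup_toList _)) (A.card + B.card - 2) _ ?_ e
    · intro r hr
      obtain ⟨v, hv, rfl⟩ := List.mem_map.1 hr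
      have hmem : (X v : MvPolynomial V k) ∈ IA ⊔ IB := by
        rcases Finset.mem_union.1 (Finset.mem_toList.1 hv) with hv | hv
        · exact Submodule.mem_sup_left (Ideal.subset_span ⟨v, hv, rfl⟩)
        · exact Submodule.mem_sup_right (Ideal.subset_span ⟨v, hv, rfl⟩)
      exact (Ideal.annihilator_quotient (I := IA ⊔ IB)).ge hmem
    · rw [List.length_map, Finset.length_toList, Finset.card_union_of_disjoint hdisj]
      lia
  obtain ⟨c, hc⟩ := exists_smul_eq_of_ext_one_eq_zero _ _ hext φ
  obtain ⟨c, rfl⟩ := Submodule.mkQ_surjective _ c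
  have coeff_eq_zero (f : MvPolynomial V k) (hf : f ∈ graphIdeal k G) (v : V) :
      coeff (Finsupp.single v 1) f = 0 := by
    by_contra h
    obtain ⟨i, j, hij, hi, hj⟩ := mem_graphIdeal.1 hf _ (mem_support_iff.2 h)
    have hi : i = v := by_contra fun h => hi (Finsupp.single_eq_of_ne h)
    have hj : j = v := by_contra fun h => hj (Finsupp.single_eq_of_ne h)
    exact hij.ne (hi.trans hj.symm)
  have coeff_X_mul_single (v : V) : coeff (Finsupp.single v 1) (X v * c) = coeff 0 c := by
    simpa using coeff_X_mul (0 : V →₀ ℕ) v c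
  have hXa : (X a : MvPolynomial V k) ∈ IA := Ideal.subset_span ⟨a, ha, rfl⟩
  have hXb : (X b : MvPolynomial V k) ∈ IB := Ideal.subset_span ⟨b, hb, rfl⟩
  have h1 : X a - X a * c ∈ graphIdeal k G :=
    (Submodule.Quotient.eq _).1 ((hφA _ hXa).symm.trans (hc ⟨X a, Submodule.mem_sup_left hXa⟩))
  have h2 : X b * c ∈ graphIdeal k G :=
    (Submodule.Quotient.mk_eq_zero _).1
      ((hc ⟨X b, Submodule.mem_sup_right hXb⟩).symm.trans (hφB _ hXb))
  have hca := coeff_eq_zero _ h1 a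
  have hcb := coeff_eq_zero _ h2 b
  rw [coeff_X_mul_single] at hcb
  rw [coeff_sub, coeff_X_mul_single, hcb, sub_zero] at hca
  simp at hca

theorem le_graphPd_of_not_preconnected_compl_induce {W : Finset V}
    (hW : ¬ (G.induce (W : Set V))ᶜ.Preconnected) :
    ((W.card - 1 : ℕ) : WithBot ℕ∞) ≤ graphPd k G := by
  classical
  simp only [SimpleGraph.Preconnected, not_forall] at hW
  obtain ⟨u, v, huv⟩ := hW
  let H := (G.induce (W : Set V))ᶜ
  let A : Finset (W : Set V) := {w | H.Reachable u w}
  let ι : (W : Set V) ↪ V := Function.Embedding.subtype _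
  have hcard : W.card = (A.map ι).card + (Aᶜ.map ι).card := by
    rw [Finset.card_map, Finset.card_map, Finset.card_add_card_compl]
    simp
  rw [hcard]
  refine le_graphPd_of_join ?_ ?_ ?_
  · exact ⟨u, Finset.mem_map.2 ⟨u, by simp [A], rfl⟩⟩
  · exact ⟨v, Finset.mem_map.2 ⟨v, by simpa [A] using huv, rfl⟩⟩
  · intro a ha b hb
    obtain ⟨a, haA, rfl⟩ := Finset.mem_map.1 ha
    obtain ⟨b, hbB, rfl⟩ := Finset.mem_map.1 hb
    simp only [A, Finset.mem_compl, Finset.mem_filter, Finset.mem_univ, true_and] at haA hbB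
    by_contra h
    have hne : a ≠ b := fun hab => hbB (hab ▸ haA)
    have hadj : H.Adj a b := (SimpleGraph.compl_adj _ _ _).2 ⟨hne, h⟩
    exact hbB (haA.trans hadj.reachable)

theorem le_graphPd_of_top_isIndContained {n : ℕ} (hn : 2 ≤ n)
    (h : (⊤ : SimpleGraph (Fin n)).IsIndContained G) :
    ((n - 1 : ℕ) : WithBot ℕ∞) ≤ graphPd k G := by
  obtain ⟨f⟩ := h
  let z : Fin n := ⟨0, by lia⟩
  have hcard : n = (({z} : Finset (Fin n)).map f.toEmbedding).card +
      (({z}ᶜ : Finset (Fin n)).map f.toEmbedding).card := by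
    rw [Finset.card_map, Finset.card_map, Finset.card_add_card_compl, Fintype.card_fin]
  rw [hcard]
  refine le_graphPd_of_join (by simp) ?_ ?_
  · exact Finset.Nonempty.map ⟨⟨1, by lia⟩, by simp [z]⟩
  · intro a ha b hb
    obtain ⟨a, haA, rfl⟩ := Finset.mem_map.1 ha
    obtain ⟨b, hbB, rfl⟩ := Finset.mem_map.1 hb
    refine f.map_rel_iff.2 ?_
    rw [SimpleGraph.top_adj]
    rintro rfl
    exact Finset.mem_compl.1 hbB haA

theorem le_graphPd_of_completeBipartiteGraph_isIndContained {n m : ℕ} (hn : 1 ≤ n) (hm : 1 ≤ m)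
    (h : (completeBipartiteGraph (Fin n) (Fin m)).IsIndContained G) :
    ((n + m - 1 : ℕ) : WithBot ℕ∞) ≤ graphPd k G := by
  obtain ⟨f⟩ := h
  have hcard : n + m =
      ((Finset.univ : Finset (Fin n)).map (Function.Embedding.inl.trans f.toEmbedding)).card +
      ((Finset.univ : Finset (Fin m)).map (Function.Embedding.inr.trans f.toEmbedding)).card := by
    simp
  rw [hcard]
  refine le_graphPd_of_join ?_ ?_ ?_
  · exact Finset.Nonempty.map ⟨⟨0, hn⟩, Finset.mem_univ _⟩
  · exact Finset.Nonempty.map ⟨⟨0, hm⟩, Finset.mem_univ _⟩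
  · intro a ha b hb
    obtain ⟨a, haA, rfl⟩ := Finset.mem_map.1 ha
    obtain ⟨b, hbB, rfl⟩ := Finset.mem_map.1 hb
    exact f.map_rel_iff.2 (by simp)

end Graph

theorem mainTheorem9 (k : Type*) [Field k] :
    (∀ (V : Type*) [Fintype V] (G : SimpleGraph V),
      (∀ W : Finset V, ¬ (G.induce (W : Set V))ᶜ.Preconnected →
        ((W.card - 1 : ℕ) : WithBot ℕ∞) ≤ graphPd k G) ∧
      (¬ Gᶜ.Preconnected → graphPd k G = ((Fintype.card V - 1 : ℕ) : WithBot ℕ∞)) ∧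
      (∀ n : ℕ, 2 ≤ n → (⊤ : SimpleGraph (Fin n)).IsIndContained G →
        ((n - 1 : ℕ) : WithBot ℕ∞) ≤ graphPd k G) ∧
      (∀ n m : ℕ, 1 ≤ n → 1 ≤ m → (completeBipartiteGraph (Fin n) (Fin m)).IsIndContained G →
        ((n + m - 1 : ℕ) : WithBot ℕ∞) ≤ graphPd k G)) ∧
    (∀ n : ℕ, 2 ≤ n →
      graphPd k (⊤ : SimpleGraph (Fin n)) = ((n - 1 : ℕ) : WithBot ℕ∞)) ∧
    (∀ n m : ℕ, 1 ≤ n → 1 ≤ m →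
      graphPd k (completeBipartiteGraph (Fin n) (Fin m)) =
        ((n + m - 1 : ℕ) : WithBot ℕ∞)) := by
  refine ⟨fun V _ G => ⟨fun W => le_graphPd_of_not_preconnected_compl_induce, fun h => ?_,
    fun n => le_graphPd_of_top_isIndContained,
    fun n m => le_graphPd_of_completeBipartiteGraph_isIndContained⟩, fun n hn => ?_,
    fun n m hn hm => ?_⟩
  · have : Nonempty V := by
      by_contra hV
      exact h fun u => (hV ⟨u⟩).elim
    refine le_antisymm graphPd_le ?_
    rw [← Finset.card_univ]
    refine le_graphPd_of_not_preconnected_compl_induce fun hu => h fun u v => ?_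
    let f : (G.induce ((Finset.univ : Finset V) : Set V))ᶜ →g Gᶜ :=
      ⟨Subtype.val, fun {a b} hab => ⟨fun h => hab.1 (Subtype.ext h), hab.2⟩⟩
    exact (hu ⟨u, by simp⟩ ⟨v, by simp⟩).map f
  · have : Nonempty (Fin n) := ⟨⟨0, by lia⟩⟩
    refine le_antisymm (graphPd_le.trans_eq (by simp)) ?_
    exact le_graphPd_of_top_isIndContained hn ⟨SimpleGraph.Embedding.refl⟩
  · have : Nonempty (Fin n ⊕ Fin m) := ⟨Sum.inl ⟨0, hn⟩⟩
    refine le_antisymm (graphPd_le.trans_eq (by simp)) ?_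
    exact le_graphPd_of_completeBipartiteGraph_isIndContained hn hm ⟨SimpleGraph.Embedding.refl⟩
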